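/- All trees are finite plane trees whose vertices are properly coloured black and white (adjacent vertices have different colours) and which, besides edges, carry half-edges, each attached to a single vertex. A half-edge is called a \emph{leaf} if it is attached to a white vertex and a \emph{bud} if it is attached to a black vertex. Half-edges count in the degree of their vertex. Each tree has at least one vertex, is rooted at one of its half-edges, and is considered up to orientation- and colour-preserving isomorphism. The \emph{total charge} of a tree is its number of leaves minus its number of buds; its \emph{charge} is the same difference without counting the root half-edge. Cutting an edge $e$ of a tree $T$ into two half-edges gives two subtrees, rooted at these new half-edges: $T_e^\bullet$, which contains the black end of $e$, and $T_e^\circ$, which contains the white end. The one that does not contain the root of $T$ is the lower subtree at $e$. $T$ is a \emph{blossom tree} if, for every edge $e$, the lower subtree at $e$ has charge at least $0$ if it is $T_e^\circ$, and charge at most $1$ if it is $T_e^\bullet$. An edge $e$ is \emph{weak} if $T_e^\bullet$ has charge at least $2$. Buds and leaves are matched as opening and closing brackets in the cyclic counterclockwise sequence of half-edges around $T$: match each bud immediately followed by a leaf, forget the matched half-edges, and repeat until no more matching is possible. A tree rooted at a leaf is \emph{balanced} if its root leaf remains unmatched. \textbf{Theorem.} Let $m\ge 1$. Let $\widehat{\mathcal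 W}_i$ (resp. $\widehat{\mathcal B}_i$) be the set of blossom trees of charge $i$ rooted at a leaf (resp. at a bud) in which the degrees of all vertices are multiples of $m$, and let $\widehat{\mathcal W}^*_i\subseteq\widehat{\mathcal W}_i$ be the subset of balanced trees. There is a bijection $$\widehat{\mathcal W}_{m-1}\longrightarrow \widehat{\mathcal W}^*_{m-1}\cup\widehat{\mathcal B}_{m+1}$$ that preserves the degree distribution (for every $k$, the number of white vertices of degree $k$ and the number of black vertices of degree $k$). It can be chosen so that it fixes every balanced tree and sends every other tree of $\widehat{\mathcal W}_{m-1}$ to the same tree re-rooted at the bud matched with its root leaf. Moreover, a blossom tree of total charge $m$ in which the degrees of all vertices are multiples of $m$ has no weak edge. -/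

import Mathlib

/-- A finite bicoloured combinatorial map with half-edges, on the set `D` of darts (a dart is
an edge together with one of its two ends, or a half-edge).
`rot` turns counterclockwise around the vertices, whose darts are thus the cycles of `rot`.
`opp` exchanges the two darts of an edge and fixes the half-edges.
Darts at the same vertex have the same colour, and the two ends of an edge have different
colours.  Connectedness is not required here. -/
structure BicoloredMap (D : Type) where
  rot : Equiv.Perm D
  opp : Equiv.Perm D
  white : D → Bool
  opp_opp : ∀ d, opp (opp d) = d
  white_rot : ∀ d, white (rot d) = white d
  white_opp : ∀ d, opp d ≠ d → white (opp d) ≠ white d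

namespace BicoloredMap

variable {D : Type} (M : BicoloredMap D)

/-- The cycles of a permutation (fixed points included), as sets. -/
def cycles (p : Equiv.Perm D) : Set (Set D) := Set.range fun d => {x | p.SameCycle d x}

/-- The dart that follows `d` when one walks counterclockwise around the map: cross to the other
end of `d` if `d` lies on an edge (stay if it is a half-edge), then turn counterclockwise. -/
def next : Equiv.Perm D := M.rot * M.opp

/-- The vertices, as sets of darts; the degree of `v` is `v.ncard`, half-edges included. -/
def vertices : Set (Set D) := cycles M.rot

/-- The edges, as pairs of darts (half-edges are not edges). -/
def edges : Set (Set D) := {e | e ∈ cycles M.opp ∧ e.ncard = 2}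

/-- The faces, as sets of darts met by a walk around the face. -/
def faces : Set (Set D) := cycles M.next

/-- `x` and `y` lie in the same connected component. -/
def Linked (x y : D) : Prop := ∃ g ∈ Subgroup.closure {M.rot, M.opp}, g x = y

def component (d : D) : Set D := {x | M.Linked d x}

/-- A connected map is planar if it satisfies Euler's formula. -/
def IsPlanar : Prop :=
  (∀ x y, M.Linked x y) ∧ M.vertices.ncard + M.faces.ncard = M.edges.ncard + 2

/-- A tree is a planar map with only one face. -/
def IsTree : Prop := M.IsPlanar ∧ M.faces.ncard = 1

def IsHalfEdge (d : D) : Prop := M.opp d = d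

/-- A leaf is a half-edge at a white vertex. -/
def IsLeaf (d : D) : Prop := M.IsHalfEdge d ∧ M.white d = true

/-- A bud is a half-edge at a black vertex. -/
def IsBud (d : D) : Prop := M.IsHalfEdge d ∧ M.white d = false

/-- Number of leaves minus number of buds among the darts in `S`. -/
noncomputable def chargeOn (S : Set D) : ℤ :=
  ({x | x ∈ S ∧ M.IsLeaf x}.ncard : ℤ) - ({x | x ∈ S ∧ M.IsBud x}.ncard : ℤ)

/-- The number of leaves minus the number of buds of the whole map. -/
noncomputable def totalCharge : ℤ := M.chargeOn Set.univ

/-- The map obtained by cutting the edge that contains `d` into the two half-edges `d` and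
`opp d` (nothing changes if `d` is a half-edge). -/
def cut [DecidableEq D] (d : D) : BicoloredMap D where
  rot := M.rot
  opp := M.opp * Equiv.swap d (M.opp d)
  white := M.white
  opp_opp x := by
    have h := M.opp_opp
    simp only [Equiv.Perm.mul_apply, Equiv.swap_apply_def]
    grind
  white_rot := M.white_rot
  white_opp x := by
    have h := M.opp_opp
    have h2 := M.white_opp
    simp only [Equiv.Perm.mul_apply, Equiv.swap_apply_def]
    grind

/-- The darts of the subtree that contains the dart `d` after the edge of `d` has been cut:
for an edge `e` this is `T_e^∘` if the end `d` of `e` is white, and `T_e^•` if it is black. -/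
def subtree [DecidableEq D] (d : D) : Set D := (M.cut d).component d

/-- The charge of that subtree, which is rooted at the half-edge `d`: leaves minus buds, the root
half-edge `d` not being counted. -/
noncomputable def subtreeCharge [DecidableEq D] (d : D) : ℤ :=
  (M.cut d).chargeOn (M.subtree d \ {d})

/-- The charge rule for the subtree at the end `d` of an edge: a nonnegative charge if it is
rooted at a white vertex, a charge at most one if it is rooted at a black vertex. -/
def ChargeRule [DecidableEq D] (d : D) : Prop :=
  if M.white d then 0 ≤ M.subtreeCharge d else M.subtreeCharge d ≤ 1

/-- The pairs (bud, leaf) that have been matched during the first `n` rounds.  In each round one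
matches the unmatched buds and leaves `b`, `l` such that `l` is the first unmatched half-edge
that follows `b` in counterclockwise direction around the map. -/
def MatchedBy : ℕ → D → D → Prop
  | 0 => fun _ _ => False
  | n + 1 => fun b l =>
    let Free : D → Prop := fun h =>
      M.IsHalfEdge h ∧ ∀ h', ¬ MatchedBy n h h' ∧ ¬ MatchedBy n h' h
    MatchedBy n b l ∨
      (M.IsBud b ∧ Free b ∧ M.IsLeaf l ∧ Free l ∧
        ∃ k : ℕ, 0 < k ∧ (M.next ^ k) b = l ∧ ∀ j, 0 < j → j < k → ¬ Free ((M.next ^ j) b))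

/-- The bud `b` and the leaf `l` are matched with each other. -/
def Matched (b l : D) : Prop := ∃ n, M.MatchedBy n b l

/-- The leaves that remain unmatched. -/
def IsSingle (l : D) : Prop := M.IsLeaf l ∧ ∀ b, ¬ M.Matched b l

/-- The number of white vertices of degree `k` (the multiplicity of the part `k` in `λ`). -/
noncomputable def whiteCount (k : ℕ) : ℕ :=
  {v | v ∈ M.vertices ∧ (∃ d ∈ v, M.white d = true) ∧ v.ncard = k}.ncard

/-- The number of black vertices of degree `k` (the multiplicity of the part `k` in `μ`). -/
noncomputable def blackCount (k : ℕ) : ℕ :=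
  {v | v ∈ M.vertices ∧ (∃ d ∈ v, M.white d = false) ∧ v.ncard = k}.ncard

end BicoloredMap

/-- A plane bicoloured tree rooted at a half-edge, with its darts labelled by `Fin size`. -/
structure LabelledTree where
  size : ℕ
  map : BicoloredMap (Fin size)
  isTree : map.IsTree
  root : Fin size
  isHalfEdge_root : map.IsHalfEdge root

namespace LabelledTree

/-- Isomorphism of rooted (oriented) maps, colours included. -/
def Iso (T U : LabelledTree) : Prop :=
  ∃ e : Fin T.size ≃ Fin U.size,
    (∀ d, e (T.map.rot d) = U.map.rot (e d)) ∧
    (∀ d, e (T.map.opp d) = U.map.opp (e d)) ∧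
    (∀ d, U.map.white (e d) = T.map.white d) ∧
    e T.root = U.root

instance setoid : Setoid LabelledTree where
  r := Iso
  iseqv := by
    refine ⟨fun T => ⟨Equiv.refl _, by simp⟩, ?_, ?_⟩
    · rintro T U ⟨e, h1, h2, h3, h4⟩
      refine ⟨e.symm, fun d => ?_, fun d => ?_, fun d => ?_, ?_⟩
      · rw [Equiv.symm_apply_eq, h1, Equiv.apply_symm_apply]
      · rw [Equiv.symm_apply_eq, h2, Equiv.apply_symm_apply]
      · rw [← h3, Equiv.apply_symm_apply]
      · rw [Equiv.symm_apply_eq, h4]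
    · rintro T U V ⟨e, h1, h2, h3, h4⟩ ⟨f, k1, k2, k3, k4⟩
      exact ⟨e.trans f, fun d => by simp [h1, k1], fun d => by simp [h2, k2],
        fun d => by simp [h3, k3], by simp [h4, k4]⟩

variable (T : LabelledTree)

/-- The charge: leaves minus buds, the root half-edge not being counted. -/
noncomputable def charge : ℤ := T.map.chargeOn (Set.univ \ {T.root})

/-- Blossom trees: at each edge, the lower subtree (the one that does not contain the root)
satisfies the charge rule corresponding to its colour. -/
def IsBlossom : Prop :=
  ∀ d, T.map.opp d ≠ d → T.root ∉ T.map.subtree d → T.map.ChargeRule d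

/-- A tree rooted at a leaf is balanced if its root is single. -/
def IsBalanced : Prop := T.map.IsSingle T.root

/-- All vertex degrees are multiples of `m`. -/
def DegreesMultipleOf (m : ℕ) : Prop := ∀ v ∈ T.map.vertices, m ∣ v.ncard

/-- Some edge `e` is weak: the subtree `T_e^•` at its black end has charge at least two. -/
def HasWeakEdge : Prop :=
  ∃ d, T.map.opp d ≠ d ∧ T.map.white d = false ∧ 2 ≤ T.map.subtreeCharge d

/-- The same tree, rooted at the half-edge `h`. -/
def reroot (h : Fin T.size) (hh : T.map.IsHalfEdge h) : LabelledTree :=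
  { T with root := h, isHalfEdge_root := hh }

end LabelledTree

/-- Plane bicoloured trees rooted at a half-edge, up to isomorphism. -/
def TreeClass : Type := Quotient LabelledTree.setoid

/-- The isomorphism class of a tree. -/
def LabelledTree.toClass (T : LabelledTree) : TreeClass := Quotient.mk _ T

/-- `Ŵ_i` for the modulus `m`: blossom trees of charge `i`, rooted at a leaf, in which the degrees
of all vertices are multiples of `m`. -/
def WHat (m : ℕ) (i : ℤ) : Set TreeClass :=
  {t | ∃ T : LabelledTree, T.toClass = t ∧ T.IsBlossom ∧ T.map.IsLeaf T.root ∧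
    T.charge = i ∧ T.DegreesMultipleOf m}

/-- `Ŵ*_i` for the modulus `m`: the balanced trees in `Ŵ_i`. -/
def WHatStar (m : ℕ) (i : ℤ) : Set TreeClass :=
  {t | ∃ T : LabelledTree, T.toClass = t ∧ T.IsBlossom ∧ T.map.IsLeaf T.root ∧
    T.charge = i ∧ T.DegreesMultipleOf m ∧ T.IsBalanced}

/-- `B̂_i` for the modulus `m`: blossom trees of charge `i`, rooted at a bud, in which the degrees
of all vertices are multiples of `m`. -/
def BHat (m : ℕ) (i : ℤ) : Set TreeClass :=
  {t | ∃ T : LabelledTree, T.toClass = t ∧ T.IsBlossom ∧ T.map.IsBud T.root ∧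
    T.charge = i ∧ T.DegreesMultipleOf m}

/-! A tree of charge `m - 1` rooted at a leaf and a tree of charge `m + 1` rooted at a bud both have
total charge `m`. The two subtrees at an edge then have charges with sum `m`
(`IsTree.subtreeCharge_add`). Since all degrees are multiples of `m`, the charge on the white side
is `-1` modulo `m` (`IsTree.dvd_subtreeCharge_add`). Hence a white charge `≥ 0` is already `≥ m -
1`, which is the same as a black charge `≤ 1`: the rule at one end of an edge gives the rule at the
other (`ChargeRule.of_opp`). Being a blossom tree therefore does not depend on the root, and no edge
is weak.

The matching does not depend on the root either, and pairs each half-edge with at most one other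
(`Matched.unique`). Moving an unbalanced root to its bud is thus injective. It is onto because
positive total charge leaves no bud unmatched (`IsTree.exists_matched`). -/

namespace BicoloredMap

variable {D : Type} (M : BicoloredMap D)

/-! ### Connected components -/

section Linked

/-- Invariance under the two generators passes to the group they generate. Connectivity arguments
below use this with a suitable `S`. -/
theorem mem_iff_of_linked {S : Set D} (hr : ∀ x, M.rot x ∈ S ↔ x ∈ S)
    (ho : ∀ x, M.opp x ∈ S ↔ x ∈ S) {x y : D} (h : M.Linked x y) : y ∈ S ↔ x ∈ S := by
  obtain ⟨g, hg, rfl⟩ := h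
  induction hg using Subgroup.closure_induction generalizing x with
  | mem g hg =>
    rcases hg with rfl | rfl
    · exact hr x
    · exact ho x
  | one => simp
  | mul g h _ _ ihg ihh => rw [Equiv.Perm.mul_apply, ihg, ihh]
  | inv g _ ih => rw [← @ih (g⁻¹ x), ← Equiv.Perm.mul_apply, mul_inv_cancel, Equiv.Perm.one_apply]

theorem mem_component_self (d : D) : d ∈ M.component d := ⟨1, one_mem _, rfl⟩

theorem apply_mem_component_iff {g : Equiv.Perm D} (hg : g ∈ Subgroup.closure {M.rot, M.opp})
    (d x : D) : g x ∈ M.component d ↔ x ∈ M.component d := by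
  constructor
  · rintro ⟨h, hh, e⟩
    exact ⟨g⁻¹ * h, mul_mem (inv_mem hg) hh, by simp [e]⟩
  · rintro ⟨h, hh, e⟩
    exact ⟨g * h, mul_mem hg hh, by simp [e]⟩

theorem rot_mem_component_iff (d x : D) : M.rot x ∈ M.component d ↔ x ∈ M.component d :=
  M.apply_mem_component_iff (Subgroup.subset_closure (by simp)) d x

theorem opp_mem_component_iff (d x : D) : M.opp x ∈ M.component d ↔ x ∈ M.component d :=
  M.apply_mem_component_iff (Subgroup.subset_closure (by simp)) d x

theorem Linked.symm {x y : D} (h : M.Linked x y) : M.Linked y x := by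
  obtain ⟨g, hg, rfl⟩ := h
  exact ⟨g⁻¹, inv_mem hg, by simp⟩

theorem Linked.trans {x y z : D} (h : M.Linked x y) (k : M.Linked y z) : M.Linked x z := by
  obtain ⟨g, hg, rfl⟩ := h
  obtain ⟨g', hg', rfl⟩ := k
  exact ⟨g' * g, mul_mem hg' hg, by simp⟩

end Linked

/-! ### Edges, and the bound on the number of vertices -/

section Edges

theorem setOf_sameCycle_opp (x : D) : {z | M.opp.SameCycle x z} = {x, M.opp x} := by
  ext z
  constructor
  · rintro ⟨i, rfl⟩
    have h2 : M.opp ^ (2 : ℤ) = 1 := by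
      ext y
      simp [zpow_ofNat, sq, M.opp_opp]
    rcases Int.even_or_odd' i with ⟨k, rfl | rfl⟩
    · left; simp [zpow_mul, h2]
    · right; simp [zpow_add, zpow_mul, h2]
  · rintro (rfl | rfl)
    · exact Equiv.Perm.SameCycle.refl _ _
    · exact ⟨1, by simp⟩

theorem mem_edges_iff (e : Set D) : e ∈ M.edges ↔ ∃ x, M.opp x ≠ x ∧ e = {x, M.opp x} := by
  constructor
  · rintro ⟨⟨x, rfl⟩, h⟩
    refine ⟨x, fun hx => ?_, M.setOf_sameCycle_opp x⟩
    simp only [M.setOf_sameCycle_opp, hx] at h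
    simp at h
  · rintro ⟨x, hx, rfl⟩
    exact ⟨⟨x, M.setOf_sameCycle_opp x⟩, Set.ncard_pair hx.symm⟩

/-- A connected map has at most one more vertex than it has edges. -/
theorem vertices_ncard_le_edges_ncard_add_one [Finite D] (h : ∀ x y, M.Linked x y) :
    M.vertices.ncard ≤ M.edges.ncard + 1 := by
  classical
  let vtx : D → M.vertices := fun d => ⟨{x | M.rot.SameCycle d x}, d, rfl⟩
  have vtx_rot : ∀ d, vtx (M.rot d) = vtx d := fun d => by
    apply Subtype.ext
    ext x
    exact Equiv.Perm.sameCycle_apply_left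
  have vtx_surj : ∀ v, ∃ d, vtx d = v := by
    rintro ⟨v, d, rfl⟩
    exact ⟨d, rfl⟩
  rcases isEmpty_or_nonempty D with hD | ⟨⟨d₀⟩⟩
  · have : M.vertices = ∅ := by
      rw [Set.eq_empty_iff_forall_notMem]
      rintro v ⟨d, -⟩
      exact hD.elim d
    simp [this]
  -- The underlying simple graph: loops and repeated edges are lost, so it has at most as many edges
  -- as the map, but it stays connected.
  let G : SimpleGraph M.vertices := SimpleGraph.fromRel fun u v => ∃ x, vtx x = u ∧ vtx (M.opp x) = v
  have hG : G.Connected := by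
    have : Nonempty M.vertices := ⟨vtx d₀⟩
    refine ⟨fun u v => ?_⟩
    obtain ⟨x, rfl⟩ := vtx_surj u
    obtain ⟨y, rfl⟩ := vtx_surj v
    have ho : ∀ z, G.Reachable (vtx x) (vtx z) → G.Reachable (vtx x) (vtx (M.opp z)) := by
      intro z hz
      by_cases e : vtx z = vtx (M.opp z)
      · rwa [← e]
      · exact hz.trans (SimpleGraph.Adj.reachable
          ((SimpleGraph.fromRel_adj _ _ _).2 ⟨e, Or.inl ⟨z, rfl, rfl⟩⟩))
    refine (M.mem_iff_of_linked (S := {z | G.Reachable (vtx x) (vtx z)}) (fun z => ?_)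
      (fun z => ⟨fun hz => ?_, ho z⟩) (h x y)).2 (SimpleGraph.Reachable.refl _)
    · simp only [Set.mem_ofPred_eq, vtx_rot]
    · have := ho _ hz
      rwa [M.opp_opp] at this
  have hE : ∀ e : G.edgeSet, ∃ x, M.opp x ≠ x ∧ (e : Sym2 M.vertices) = s(vtx x, vtx (M.opp x)) := by
    rintro ⟨e, he⟩
    induction e with
    | _ u v =>
      obtain ⟨huv, ⟨x, rfl, rfl⟩ | ⟨x, rfl, rfl⟩⟩ :=
        (SimpleGraph.fromRel_adj _ _ _).1 ((SimpleGraph.mem_edgeSet _).1 he)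
      · exact ⟨x, fun hx => huv (by rw [hx]), rfl⟩
      · exact ⟨x, fun hx => huv (by rw [hx]), Sym2.eq_swap⟩
  choose x hx hex using hE
  have hle : Nat.card G.edgeSet ≤ Nat.card M.edges := by
    refine Nat.card_le_card_of_injective
      (fun e => ⟨{x e, M.opp (x e)}, (M.mem_edges_iff _).2 ⟨x e, hx e, rfl⟩⟩) fun e e' hee => ?_
    apply Subtype.ext
    have : x e ∈ ({x e', M.opp (x e')} : Set D) := by
      have h : ({x e, M.opp (x e)} : Set D) = {x e', M.opp (x e')} := congrArg Subtype.val hee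
      exact h ▸ Set.mem_insert _ _
    rw [hex e, hex e']
    rcases this with h1 | h1
    · rw [h1]
    · rw [Set.mem_singleton_iff.1 h1, M.opp_opp, Sym2.eq_swap]
  have := hG.card_vert_le_card_edgeSet_add_one
  simp only [Nat.card_coe_set_eq] at this hle
  omega

end Edges

/-! ### Cutting an edge of a tree -/

section Cut

variable [DecidableEq D] (d : D)

theorem cut_opp_apply (x : D) :
    (M.cut d).opp x = if x = d ∨ x = M.opp d then x else M.opp x := by
  have h := M.opp_opp
  simp only [cut, Equiv.Perm.mul_apply, Equiv.swap_apply_def]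
  grind

theorem cut_opp (x : D) (h1 : x ≠ d) (h2 : x ≠ M.opp d) : (M.cut d).opp x = M.opp x := by
  simp [cut_opp_apply, h1, h2]

theorem mem_subtree_self : d ∈ M.subtree d := mem_component_self _ d

theorem rot_mem_subtree_iff (x : D) : M.rot x ∈ M.subtree d ↔ x ∈ M.subtree d :=
  (M.cut d).rot_mem_component_iff d x

theorem cut_opp_eq : M.cut (M.opp d) = M.cut d := by
  have : (M.cut (M.opp d)).opp = (M.cut d).opp := by
    ext x
    simp only [cut_opp_apply, M.opp_opp, or_comm]
  simp only [cut] at this ⊢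
  simp [this]

theorem opp_mem_subtree_iff {x : D} (h1 : x ≠ d) (h2 : x ≠ M.opp d) :
    M.opp x ∈ M.subtree d ↔ x ∈ M.subtree d := by
  rw [← M.cut_opp d x h1 h2]
  exact (M.cut d).opp_mem_component_iff d x

variable {d}

theorem cut_edges_ncard_lt [Finite D] (hd : M.opp d ≠ d) :
    (M.cut d).edges.ncard < M.edges.ncard := by
  refine Set.ncard_lt_ncard ⟨fun e he => ?_, fun h => ?_⟩
  · obtain ⟨x, hx, rfl⟩ := (mem_edges_iff _ _).1 he
    rw [cut_opp_apply] at hx ⊢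
    split_ifs at hx ⊢ with h
    · exact absurd rfl hx
    · exact (M.mem_edges_iff _).2 ⟨x, hx, rfl⟩
  · obtain ⟨x, hx, e⟩ := (mem_edges_iff _ _).1 (h ((M.mem_edges_iff _).2 ⟨d, hd, rfl⟩))
    have hxe : x ∈ ({d, M.opp d} : Set D) := e ▸ Set.mem_insert _ _
    apply hx
    rw [cut_opp_apply]
    exact if_pos hxe

/-- Every edge of a tree is a bridge. -/
theorem IsTree.opp_notMem_subtree [Finite D] (hM : M.IsTree) (hd : M.opp d ≠ d) :
    M.opp d ∉ M.subtree d := by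
  intro h
  -- If the two ends stay linked after the cut, the cut map is still connected.
  have hall : ∀ x, (M.cut d).Linked d x := by
    intro x
    refine (M.mem_iff_of_linked (S := M.subtree d) (M.rot_mem_subtree_iff d) (fun z => ?_)
      (hM.1.1 d x)).2 (M.mem_subtree_self d)
    by_cases h1 : z = d
    · subst h1
      simp [h, mem_subtree_self]
    by_cases h2 : z = M.opp d
    · subst h2
      simp [h, mem_subtree_self, M.opp_opp]
    exact M.opp_mem_subtree_iff d h1 h2
  -- A connected cut map has at most as many vertices as `M` has edges, whereas Euler's formula with
  -- one face gives one vertex more.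
  have h1 := (M.cut d).vertices_ncard_le_edges_ncard_add_one fun x y =>
    ((hall x).symm).trans _ (hall y)
  have h2 := M.cut_edges_ncard_lt hd
  have h3 := hM.1.2
  have h4 := hM.2
  have h5 : (M.cut d).vertices = M.vertices := rfl
  rw [h5] at h1
  omega

theorem IsTree.disjoint_subtree [Finite D] (hM : M.IsTree) (hd : M.opp d ≠ d) :
    Disjoint (M.subtree d) (M.subtree (M.opp d)) := by
  rw [Set.disjoint_left]
  intro x hx hx'
  refine hM.opp_notMem_subtree M hd (Linked.trans _ hx ?_)
  rw [subtree, cut_opp_eq] at hx'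
  exact Linked.symm _ hx'

theorem IsTree.subtree_union [Finite D] (hM : M.IsTree) :
    M.subtree d ∪ M.subtree (M.opp d) = Set.univ := by
  refine Set.eq_univ_of_forall fun x => ?_
  refine (M.mem_iff_of_linked (fun z => ?_) (fun z => ?_) (hM.1.1 d x)).2
    (Or.inl (M.mem_subtree_self d))
  · simp only [Set.mem_union, rot_mem_subtree_iff]
  · by_cases h1 : z = d
    · subst h1
      simp [mem_subtree_self]
    by_cases h2 : z = M.opp d
    · subst h2
      simp [mem_subtree_self, M.opp_opp]
    rw [Set.mem_union, Set.mem_union, M.opp_mem_subtree_iff d h1 h2,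
      M.opp_mem_subtree_iff (M.opp d) h2 (by rwa [M.opp_opp])]

end Cut

/-! ### Charges of subtrees, and their residues modulo `m` -/

section Charge

theorem chargeOn_union [Finite D] {S T : Set D} (h : Disjoint S T) :
    M.chargeOn (S ∪ T) = M.chargeOn S + M.chargeOn T := by
  have key : ∀ P : D → Prop, {x | x ∈ S ∪ T ∧ P x}.ncard =
      {x | x ∈ S ∧ P x}.ncard + {x | x ∈ T ∧ P x}.ncard := by
    intro P
    rw [← Set.ncard_union_eq (h.mono (fun x hx => hx.1) (fun x hx => hx.1))]
    congr 1
    ext x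
    simp [or_and_right]
  simp only [chargeOn, key]
  push_cast
  ring

theorem chargeOn_singleton_of_isLeaf {d : D} (h : M.IsLeaf d) : M.chargeOn {d} = 1 := by
  have h1 : {x | x ∈ ({d} : Set D) ∧ M.IsLeaf x} = {d} := by
    ext x; simp only [Set.mem_ofPred_eq, Set.mem_singleton_iff]; grind
  have h2 : {x | x ∈ ({d} : Set D) ∧ M.IsBud x} = ∅ := by
    ext x; simp only [Set.mem_ofPred_eq, Set.mem_singleton_iff]; grind [IsLeaf, IsBud]
  rw [chargeOn, h1, h2]
  simp

theorem chargeOn_singleton_of_isBud {d : D} (h : M.IsBud d) : M.chargeOn {d} = -1 := by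
  have h1 : {x | x ∈ ({d} : Set D) ∧ M.IsBud x} = {d} := by
    ext x; simp only [Set.mem_ofPred_eq, Set.mem_singleton_iff]; grind
  have h2 : {x | x ∈ ({d} : Set D) ∧ M.IsLeaf x} = ∅ := by
    ext x; simp only [Set.mem_ofPred_eq, Set.mem_singleton_iff]; grind [IsLeaf, IsBud]
  rw [chargeOn, h1, h2]
  simp

theorem chargeOn_compl_singleton [Finite D] (d : D) :
    M.chargeOn (Set.univ \ {d}) = M.totalCharge - M.chargeOn {d} := by
  rw [totalCharge, ← Set.sdiff_union_of_subset (Set.subset_univ {d}),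
    chargeOn_union _ Set.disjoint_sdiff_left]
  simp

/-- Such an `S` is a disjoint union of vertices. -/
theorem dvd_ncard_of_rot_invariant [Finite D] {m : ℕ} (hm : ∀ v ∈ M.vertices, m ∣ v.ncard)
    {S : Set D} (hS : ∀ x, M.rot x ∈ S ↔ x ∈ S) : m ∣ S.ncard := by
  classical
  have := Fintype.ofFinite D
  have hcyc : ∀ x y, M.rot.SameCycle x y → (y ∈ S ↔ x ∈ S) := by
    rintro x y ⟨i, rfl⟩
    induction i generalizing x with
    | zero => simp
    | succ n ih => rw [add_comm, zpow_add, Equiv.Perm.mul_apply, zpow_one, hS, ih]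
    | pred n ih =>
      rw [← ih x, ← hS, ← Equiv.Perm.mul_apply, ← zpow_one_add]
      ring_nf
  let vtx : D → Set D := fun x => {y | M.rot.SameCycle x y}
  rw [Set.ncard_eq_toFinset_card', Finset.card_eq_sum_card_image vtx]
  refine Finset.dvd_sum fun v hv => ?_
  obtain ⟨x, hx, rfl⟩ := Finset.mem_image.1 hv
  rw [Set.mem_toFinset] at hx
  have : (vtx x).ncard = {y ∈ S.toFinset | vtx y = vtx x}.card := by
    rw [← Set.ncard_coe_finset]
    congr 1
    ext y
    simp only [Finset.coe_filter, Set.mem_toFinset, Set.mem_ofPred_eq]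
    constructor
    · intro (h : M.rot.SameCycle x y)
      refine ⟨(hcyc x y h).2 hx, ?_⟩
      ext z
      exact ⟨h.trans, h.symm.trans⟩
    · rintro ⟨-, h⟩
      rw [← h]
      exact Equiv.Perm.SameCycle.refl _ _
  rw [← this]
  exact hm _ ⟨x, rfl⟩

variable [DecidableEq D] {d : D}

/-- The cut creates the half-edges `d` and `opp d`; the first is excluded from the count and the
second lies on the other side, so only half-edges of `M` are counted. -/
theorem IsTree.subtreeCharge_eq [Finite D] (hM : M.IsTree) (hd : M.opp d ≠ d) :
    M.subtreeCharge d = M.chargeOn (M.subtree d) := by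
  have hn := hM.opp_notMem_subtree M hd
  have key : ∀ x, (x ∈ M.subtree d \ {d} ∧ (M.cut d).IsHalfEdge x) ↔
      (x ∈ M.subtree d ∧ M.IsHalfEdge x) := by
    intro x
    simp only [Set.mem_sdiff, Set.mem_singleton_iff, IsHalfEdge, cut_opp_apply]
    grind
  have hw : (M.cut d).white = M.white := rfl
  simp only [subtreeCharge, chargeOn, IsLeaf, IsBud, ← and_assoc, key, hw]

theorem IsTree.subtreeCharge_add [Finite D] (hM : M.IsTree) (hd : M.opp d ≠ d) :
    M.subtreeCharge d + M.subtreeCharge (M.opp d) = M.totalCharge := by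
  rw [hM.subtreeCharge_eq M hd, hM.subtreeCharge_eq M (by rw [M.opp_opp]; exact hd.symm),
    ← chargeOn_union _ (hM.disjoint_subtree M hd), hM.subtree_union, totalCharge]

/-- The charge of a subtree, in terms of the numbers of its white and of its black darts. -/
theorem IsTree.chargeOn_subtree [Finite D] (hM : M.IsTree) (hd : M.opp d ≠ d) :
    M.chargeOn (M.subtree d) = ({x | x ∈ M.subtree d ∧ M.white x = true}.ncard : ℤ)
      - ({x | x ∈ M.subtree d ∧ M.white x = false}.ncard : ℤ)
      - (if M.white d then 1 else -1) := by
  have hn := hM.opp_notMem_subtree M hd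
  -- The darts of colour `c` on the edges interior to the subtree. `opp` exchanges the two colours,
  -- so these cancel in the difference; only the unpaired dart `d` leaves a correction.
  let I : Bool → Set D := fun c =>
    {x | x ∈ M.subtree d ∧ x ≠ d ∧ M.opp x ≠ x ∧ M.white x = c}
  have hsplit : ∀ c, {x | x ∈ M.subtree d ∧ M.white x = c}.ncard =
      {x | x ∈ M.subtree d ∧ M.IsHalfEdge x ∧ M.white x = c}.ncard + (I c).ncard +
        (if M.white d = c then 1 else 0) := by
    intro c
    have h1 : {x | x ∈ M.subtree d ∧ M.white x = c} =
        ({x | x ∈ M.subtree d ∧ M.IsHalfEdge x ∧ M.white x = c} ∪ I c) ∪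
          {x | x = d ∧ M.white d = c} := by
      have := M.mem_subtree_self d
      ext x
      simp only [Set.mem_ofPred_eq, Set.mem_union, IsHalfEdge, I]
      grind
    have h2 : {x | x = d ∧ M.white d = c}.ncard = if M.white d = c then 1 else 0 := by
      split_ifs with h <;> simp [h]
    rw [h1, Set.ncard_union_eq, Set.ncard_union_eq, h2]
    · rw [Set.disjoint_left]
      rintro x ⟨-, hx, -⟩ ⟨-, -, hx', -⟩
      exact hx' hx
    · rw [Set.disjoint_left]
      rintro x (⟨-, hx, -⟩ | ⟨-, hx, -⟩) ⟨rfl, -⟩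
      · exact hd hx
      · exact hx rfl
  have hI : (I true).ncard = (I false).ncard := by
    refine Set.ncard_congr (fun x _ => M.opp x) ?_ (fun x y _ _ h => M.opp.injective h) ?_
    · rintro x ⟨hx, hxd, hxo, hw⟩
      have hxo' : x ≠ M.opp d := fun h => hn (h ▸ hx)
      refine ⟨(M.opp_mem_subtree_iff d hxd hxo').2 hx, ?_, ?_, ?_⟩
      · rintro rfl
        exact hxo' (M.opp_opp x).symm
      · rw [M.opp_opp]
        exact hxo.symm
      · simpa [hw] using M.white_opp x hxo
    · rintro x ⟨hx, hxd, hxo, hw⟩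
      have hxo' : x ≠ M.opp d := fun h => hn (h ▸ hx)
      refine ⟨M.opp x, ⟨(M.opp_mem_subtree_iff d hxd hxo').2 hx, ?_, ?_, ?_⟩, M.opp_opp x⟩
      · rintro rfl
        exact hxo' (M.opp_opp x).symm
      · rw [M.opp_opp]
        exact hxo.symm
      · simpa [hw] using M.white_opp x hxo
  simp only [hsplit, chargeOn, IsLeaf, IsBud]
  cases M.white d <;> simp [hI] <;> ring

/-- If all degrees are multiples of `m`, the charge of a subtree is, modulo `m`, equal to `-1` if
its root is white and to `1` if its root is black. -/
theorem IsTree.dvd_subtreeCharge_add [Finite D] (hM : M.IsTree) (hd : M.opp d ≠ d) {m : ℕ}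
    (hm : ∀ v ∈ M.vertices, m ∣ v.ncard) :
    (m : ℤ) ∣ M.subtreeCharge d + (if M.white d then 1 else -1) := by
  have h : ∀ c, (m : ℤ) ∣ ({x | x ∈ M.subtree d ∧ M.white x = c}.ncard : ℤ) := fun c =>
    Int.natCast_dvd_natCast.2 <| M.dvd_ncard_of_rot_invariant hm fun x => by
      simp only [Set.mem_ofPred_eq, rot_mem_subtree_iff, M.white_rot]
  rw [hM.subtreeCharge_eq M hd, hM.chargeOn_subtree M hd, sub_add_cancel]
  exact dvd_sub (h _) (h _)

/-- From black to white, the sum `m` suffices. From white to black, the white charge plus one is a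
positive multiple of `m`, hence at least `m`, which leaves at most one for the black side. -/
theorem ChargeRule.of_opp [Finite D] (hM : M.IsTree) (hd : M.opp d ≠ d) {m : ℕ}
    (hm : ∀ v ∈ M.vertices, m ∣ v.ncard) (h1 : 1 ≤ m) (ht : M.totalCharge = m)
    (h : M.ChargeRule (M.opp d)) : M.ChargeRule d := by
  have hadd := hM.subtreeCharge_add M hd
  have hdvd := hM.dvd_subtreeCharge_add M (d := M.opp d) (by rw [M.opp_opp]; exact hd.symm) hm
  have hw := M.white_opp d hd
  rw [ht] at hadd
  simp only [ChargeRule] at h ⊢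
  cases hwd : M.white d
  · have hwo : M.white (M.opp d) = true := by simpa [hwd] using hw
    simp only [hwo, if_true, Bool.false_eq_true, if_false] at h hdvd ⊢
    have := Int.le_of_dvd (by omega) hdvd
    omega
  · have hwo : M.white (M.opp d) = false := by simpa [hwd] using hw
    simp only [hwo, if_true, Bool.false_eq_true, if_false] at h ⊢
    omega

end Charge

end BicoloredMap

namespace BicoloredMap

variable {D : Type} (M : BicoloredMap D)

/-! ### Matching of buds and leaves -/

section Matching

theorem MatchedBy.isBud {n : ℕ} {b l : D} (h : M.MatchedBy n b l) : M.IsBud b := by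
  induction n with
  | zero => exact h.elim
  | succ n ih => exact h.elim ih fun h => h.1

theorem MatchedBy.isLeaf {n : ℕ} {b l : D} (h : M.MatchedBy n b l) : M.IsLeaf l := by
  induction n with
  | zero => exact h.elim
  | succ n ih => exact h.elim ih fun h => h.2.2.1

theorem MatchedBy.mono {n k : ℕ} (hnk : n ≤ k) {b l : D} (h : M.MatchedBy n b l) :
    M.MatchedBy k b l := by
  induction hnk with
  | refl => exact h
  | step _ ih => exact Or.inl ih

/-- A new pair uses only free half-edges, so it cannot share one with an older pair. Two pairs of
the same round that share an end coincide, because no free half-edge lies strictly between a bud and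
its leaf. -/
theorem MatchedBy.unique {n : ℕ} {b b' l l' : D} (h : M.MatchedBy n b l)
    (h' : M.MatchedBy n b' l') : b = b' ↔ l = l' := by
  induction n generalizing b b' l l' with
  | zero => exact h.elim
  | succ n ih =>
    rcases h with h | ⟨-, hb, -, hl, k, hk, hkl, hmin⟩ <;>
      rcases h' with h' | ⟨-, hb', -, hl', k', hk', hkl', hmin'⟩
    · exact ih h h'
    · constructor
      · rintro rfl
        exact absurd h (hb'.2 l).1
      · rintro rfl
        exact absurd h (hl'.2 b).2
    · constructor
      · rintro rfl
        exact absurd h' (hb.2 l').1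
      · rintro rfl
        exact absurd h' (hl.2 b').2
    · constructor
      · rintro rfl
        rcases lt_trichotomy k k' with hlt | rfl | hlt
        · exact absurd (hkl ▸ hl) (hmin' k hk hlt)
        · exact hkl.symm.trans hkl'
        · exact absurd (hkl' ▸ hl') (hmin k' hk' hlt)
      · rintro rfl
        -- When walks from two buds end at the same leaf, the longer one passes through the start of
        -- the shorter, which is a free bud.
        have aux : ∀ {i j : ℕ} {x y : D}, i < j → (M.next ^ i) x = (M.next ^ j) y →
            (M.next ^ (j - i)) y = x := by
          intro i j x y hij hxy
          apply (M.next ^ i).injective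
          rw [hxy, ← Equiv.Perm.mul_apply, ← pow_add, Nat.add_sub_cancel' hij.le]
        rcases lt_trichotomy k k' with hlt | rfl | hlt
        · have := aux hlt (hkl.trans hkl'.symm)
          exact absurd (this.symm ▸ hb) (hmin' (k' - k) (by omega) (by omega))
        · exact (M.next ^ k).injective (hkl.trans hkl'.symm)
        · have := aux hlt (hkl'.trans hkl.symm)
          exact absurd (this.symm ▸ hb') (hmin (k - k') (by omega) (by omega))

variable {M}

theorem Matched.isBud {b l : D} (h : M.Matched b l) : M.IsBud b := h.elim fun _ h => h.isBud

theorem Matched.isLeaf {b l : D} (h : M.Matched b l) : M.IsLeaf l := h.elim fun _ h => h.isLeaf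

theorem Matched.unique {b b' l l' : D} (h : M.Matched b l) (h' : M.Matched b' l') :
    b = b' ↔ l = l' := by
  obtain ⟨n, h⟩ := h
  obtain ⟨n', h'⟩ := h'
  exact (h.mono M (le_max_left n n')).unique M (h'.mono M (le_max_right n n'))

variable (M)

/-- The matching stabilises, since there are finitely many pairs and the rounds are monotone. -/
theorem exists_forall_matched_iff_matchedBy [Finite D] :
    ∃ n, ∀ b l, M.Matched b l ↔ M.MatchedBy n b l := by
  have hN : ∀ p : D × D, ∃ n, M.Matched p.1 p.2 → M.MatchedBy n p.1 p.2 := by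
    intro p
    by_cases h : M.Matched p.1 p.2
    · exact h.imp fun n hn _ => hn
    · exact ⟨0, fun h' => absurd h' h⟩
  choose N hN using hN
  obtain ⟨B, hB⟩ := (Set.finite_range N).bddAbove
  exact ⟨B, fun b l => ⟨fun h => (hN (b, l) h).mono M (hB ⟨(b, l), rfl⟩), fun h => ⟨B, h⟩⟩⟩

/-- Otherwise the matching would inject the leaves into the buds. -/
theorem exists_isSingle [Finite D] (hpos : 0 < M.totalCharge) : ∃ l, M.IsSingle l := by
  by_contra! hno
  have hl : ∀ l, M.IsLeaf l → ∃ b, M.Matched b l := by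
    intro l hl
    by_contra! h
    exact hno l ⟨hl, h⟩
  choose f hf using hl
  have : {x | x ∈ Set.univ ∧ M.IsLeaf x}.ncard ≤ {x | x ∈ Set.univ ∧ M.IsBud x}.ncard := by
    classical
    refine Set.ncard_le_ncard_of_injOn (fun x => if h : M.IsLeaf x then f x h else x) ?_ ?_
    · rintro x ⟨-, hx⟩
      simp only [dif_pos hx]
      exact ⟨trivial, (hf x hx).isBud⟩
    · rintro x ⟨-, hx⟩ y ⟨-, hy⟩ h
      simp only [dif_pos hx, dif_pos hy] at h
      exact ((hf x hx).unique (hf y hy)).1 h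
  simp only [totalCharge, chargeOn] at hpos
  omega

theorem IsTree.sameCycle_next (hM : M.IsTree) (x y : D) : M.next.SameCycle x y := by
  obtain ⟨F, hF⟩ := Set.ncard_eq_one.1 hM.2
  have h : ∀ z, {w | M.next.SameCycle z w} = F := fun z => by
    have : {w | M.next.SameCycle z w} ∈ M.faces := ⟨z, rfl⟩
    rwa [hF] at this
  have hy : y ∈ {w | M.next.SameCycle x w} := by
    rw [h x, ← h y]
    exact Equiv.Perm.SameCycle.refl _ _
  exact hy

/-- In a tree of positive total charge, every bud is matched. -/
theorem IsTree.exists_matched [Finite D] (hM : M.IsTree) (hpos : 0 < M.totalCharge) {b : D}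
    (hb : M.IsBud b) : ∃ l, M.Matched b l := by
  classical
  by_contra! hno
  have := Fintype.ofFinite D
  obtain ⟨n, hn⟩ := M.exists_forall_matched_iff_matchedBy
  obtain ⟨l, hl, hls⟩ := M.exists_isSingle hpos
  let Free : D → Prop := fun h => M.IsHalfEdge h ∧ ∀ h', ¬ M.MatchedBy n h h' ∧ ¬ M.MatchedBy n h' h
  have notBudLeaf : ∀ x, M.IsBud x → M.IsLeaf x → False := by
    rintro x ⟨-, h⟩ ⟨-, h'⟩
    simp [h] at h'
  have hbF : Free b := ⟨hb.1, fun h' => ⟨fun h => hno h' ⟨n, h⟩,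
    fun h => notBudLeaf b hb (h.isLeaf M)⟩⟩
  have hlF : Free l := ⟨hl.1, fun h' => ⟨fun h => notBudLeaf l (h.isBud M) hl,
    fun h => hls h' ⟨n, h⟩⟩⟩
  have hex : ∃ k, Free ((M.next ^ k) b) ∧ M.IsLeaf ((M.next ^ k) b) := by
    obtain ⟨k, -, -, hk⟩ := (hM.sameCycle_next M b l).exists_pow_eq
    exact ⟨k, hk ▸ ⟨hlF, hl⟩⟩
  -- Position of the first free leaf after `b`. With `j` the last free position before it, position
  -- `j` carries a bud by minimality of `k`, so one more round would match it, although the matching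
  -- is stable after `n` rounds.
  let k := Nat.find hex
  obtain ⟨hkF, hkL⟩ : Free ((M.next ^ k) b) ∧ M.IsLeaf ((M.next ^ k) b) := Nat.find_spec hex
  have hkpos : 0 < k := Nat.pos_of_ne_zero fun h => by
    rw [h] at hkL
    exact notBudLeaf b hb hkL
  let P : ℕ → Prop := fun j => Free ((M.next ^ j) b)
  let j := Nat.findGreatest P (k - 1)
  have hjF : Free ((M.next ^ j) b) :=
    Nat.findGreatest_spec (P := P) (Nat.zero_le _) hbF
  have hjk : j ≤ k - 1 := Nat.findGreatest_le _
  have hjB : M.IsBud ((M.next ^ j) b) := by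
    refine ⟨hjF.1, ?_⟩
    by_contra hw
    exact Nat.find_min hex (m := j) (by omega) ⟨hjF, hjF.1, by simpa using hw⟩
  have hadd : ∀ i, (M.next ^ i) ((M.next ^ j) b) = (M.next ^ (j + i)) b := fun i => by
    rw [← Equiv.Perm.mul_apply, ← pow_add, add_comm]
  have hnew : M.MatchedBy (n + 1) ((M.next ^ j) b) ((M.next ^ k) b) := by
    refine Or.inr ⟨hjB, hjF, hkL, hkF, k - j, by omega, ?_, fun i hi hik => ?_⟩
    · rw [hadd, Nat.add_sub_cancel' (by omega)]
    · rw [hadd]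
      exact Nat.findGreatest_is_greatest (P := P) (n := k - 1) (k := j + i) (by omega) (by omega)
  exact (hjF.2 _).1 ((hn _ _).1 ⟨n + 1, hnew⟩)

end Matching

/-- An isomorphism of maps (orientation and colours are preserved). -/
structure Isom {E : Type} (M : BicoloredMap D) (N : BicoloredMap E) (e : D ≃ E) : Prop where
  rot : ∀ d, e (M.rot d) = N.rot (e d)
  opp : ∀ d, e (M.opp d) = N.opp (e d)
  white : ∀ d, N.white (e d) = M.white d

/-! ### Invariance under isomorphism -/

namespace Isom

variable {E : Type} {M} {N : BicoloredMap E} {e : D ≃ E} (h : Isom M N e)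
include h

theorem isHalfEdge_iff (x : D) : N.IsHalfEdge (e x) ↔ M.IsHalfEdge x := by
  simp [IsHalfEdge, ← h.opp]

theorem isLeaf_iff (x : D) : N.IsLeaf (e x) ↔ M.IsLeaf x := by
  simp [IsLeaf, h.isHalfEdge_iff, h.white]

theorem isBud_iff (x : D) : N.IsBud (e x) ↔ M.IsBud x := by
  simp [IsBud, h.isHalfEdge_iff, h.white]

theorem next_pow (k : ℕ) (x : D) : (N.next ^ k) (e x) = e ((M.next ^ k) x) := by
  induction k with
  | zero => simp
  | succ k ih =>
    rw [pow_succ', pow_succ', Equiv.Perm.mul_apply, Equiv.Perm.mul_apply, ih]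
    simp [next, h.rot, h.opp]

theorem matchedBy_iff (n : ℕ) (b l : D) : N.MatchedBy n (e b) (e l) ↔ M.MatchedBy n b l := by
  induction n generalizing b l with
  | zero => rfl
  | succ n ih =>
    simp only [MatchedBy, ih, h.isBud_iff, h.isLeaf_iff, h.isHalfEdge_iff, h.next_pow,
      ← e.forall_congr_right, e.apply_eq_iff_eq]

theorem matched_iff (b l : D) : N.Matched (e b) (e l) ↔ M.Matched b l :=
  exists_congr fun n => h.matchedBy_iff n b l

theorem isSingle_iff (l : D) : N.IsSingle (e l) ↔ M.IsSingle l := by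
  simp only [IsSingle, h.isLeaf_iff, ← e.forall_congr_right, h.matched_iff]

theorem image_sameCycle_rot (x : D) :
    e '' {y | M.rot.SameCycle x y} = {y | N.rot.SameCycle (e x) y} := by
  have hz : ∀ i : ℤ, ∀ z, (N.rot ^ i) (e z) = e ((M.rot ^ i) z) := by
    have hrot : N.rot = e.permCongrHom M.rot := by
      ext y
      simp [Equiv.permCongr_apply, h.rot]
    intro i z
    rw [hrot, ← map_zpow]
    simp [Equiv.permCongr_apply]
  ext y
  obtain ⟨y, rfl⟩ := e.surjective y
  simp only [e.injective.mem_set_image, Set.mem_ofPred_eq, Equiv.Perm.SameCycle, hz,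
    e.apply_eq_iff_eq]

theorem image_vertices : Set.image e '' M.vertices = N.vertices := by
  ext v
  constructor
  · rintro ⟨_, ⟨x, rfl⟩, rfl⟩
    exact ⟨e x, (h.image_sameCycle_rot x).symm⟩
  · rintro ⟨x, rfl⟩
    obtain ⟨x, rfl⟩ := e.surjective x
    exact ⟨_, ⟨x, rfl⟩, h.image_sameCycle_rot x⟩

theorem ncard_vertices_colour (c : Bool) (k : ℕ) :
    {v | v ∈ N.vertices ∧ (∃ d ∈ v, N.white d = c) ∧ v.ncard = k}.ncard =
      {v | v ∈ M.vertices ∧ (∃ d ∈ v, M.white d = c) ∧ v.ncard = k}.ncard := by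
  rw [← Set.ncard_image_of_injective _ (Set.image_injective.2 e.injective)]
  congr 1
  ext v
  obtain ⟨v, rfl⟩ := Set.image_surjective.2 e.surjective v
  rw [(Set.image_injective.2 e.injective).mem_set_image]
  simp only [Set.mem_ofPred_eq, ← h.image_vertices, Set.exists_mem_image, h.white,
    (Set.image_injective.2 e.injective).mem_set_image, Set.ncard_image_of_injective _ e.injective]

theorem whiteCount_eq (k : ℕ) : N.whiteCount k = M.whiteCount k := h.ncard_vertices_colour true k

theorem blackCount_eq (k : ℕ) : N.blackCount k = M.blackCount k := h.ncard_vertices_colour false k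

end Isom

end BicoloredMap

/-! ### Rooted trees and independence of the root -/

namespace LabelledTree

variable {T U : LabelledTree}

theorem toClass_eq_iff : T.toClass = U.toClass ↔
    ∃ e : Fin T.size ≃ Fin U.size, T.map.Isom U.map e ∧ e T.root = U.root :=
  Quotient.eq.trans ⟨fun ⟨e, h1, h2, h3, h4⟩ => ⟨e, ⟨h1, h2, h3⟩, h4⟩,
    fun ⟨e, ⟨h1, h2, h3⟩, h4⟩ => ⟨e, h1, h2, h3, h4⟩⟩

theorem isLeaf_root_iff (h : T.toClass = U.toClass) :
    T.map.IsLeaf T.root ↔ U.map.IsLeaf U.root := by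
  obtain ⟨e, he, hr⟩ := toClass_eq_iff.1 h
  rw [← hr, he.isLeaf_iff]

theorem isBalanced_iff (h : T.toClass = U.toClass) : T.IsBalanced ↔ U.IsBalanced := by
  obtain ⟨e, he, hr⟩ := toClass_eq_iff.1 h
  rw [IsBalanced, IsBalanced, ← hr, he.isSingle_iff]

theorem counts_eq (h : T.toClass = U.toClass) (k : ℕ) :
    U.map.whiteCount k = T.map.whiteCount k ∧ U.map.blackCount k = T.map.blackCount k := by
  obtain ⟨e, he, -⟩ := toClass_eq_iff.1 h
  exact ⟨he.whiteCount_eq k, he.blackCount_eq k⟩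

theorem charge_of_isLeaf (h : T.map.IsLeaf T.root) : T.charge = T.map.totalCharge - 1 := by
  rw [charge, T.map.chargeOn_compl_singleton, T.map.chargeOn_singleton_of_isLeaf h]

theorem charge_of_isBud (h : T.map.IsBud T.root) : T.charge = T.map.totalCharge + 1 := by
  rw [charge, T.map.chargeOn_compl_singleton, T.map.chargeOn_singleton_of_isBud h, sub_neg_eq_add]

theorem exists_matched_root (hl : T.map.IsLeaf T.root) (hb : ¬ T.IsBalanced) :
    ∃ b, T.map.Matched b T.root := by
  by_contra! h
  exact hb ⟨hl, h⟩

section TotalCharge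

variable {m : ℕ} (hm : 1 ≤ m) (hd : T.DegreesMultipleOf m) (ht : T.map.totalCharge = m)
include hm hd ht

/-- If the total charge is `m` and all degrees are multiples of `m`, the charge rule holds at both
ends of every edge of a blossom tree. -/
theorem IsBlossom.chargeRule (hT : T.IsBlossom) (d : Fin T.size) (h : T.map.opp d ≠ d) :
    T.map.ChargeRule d := by
  by_cases hr : T.root ∈ T.map.subtree d
  -- Here the lower subtree is the one at `opp d`; its rule is transferred to `d`.
  · refine .of_opp T.map T.isTree h hd hm ht (hT _ (by rw [T.map.opp_opp]; exact h.symm) ?_)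
    exact Set.disjoint_left.1 (T.isTree.disjoint_subtree T.map h) hr
  · exact hT d h hr

theorem IsBlossom.reroot (hT : T.IsBlossom) (h : Fin T.size) (hh : T.map.IsHalfEdge h) :
    (T.reroot h hh).IsBlossom :=
  fun d hd' _ => hT.chargeRule hm hd ht d hd'

theorem IsBlossom.not_hasWeakEdge (hT : T.IsBlossom) : ¬ T.HasWeakEdge := by
  rintro ⟨d, hd', hw, h2⟩
  have := hT.chargeRule hm hd ht d hd'
  simp only [BicoloredMap.ChargeRule, hw, Bool.false_eq_true, if_false] at this
  omega

end TotalCharge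

end LabelledTree

/-- The tree `u` is obtained from the tree `t`, rooted at a leaf, by keeping the root if it is
single, and by moving it to the matching bud otherwise. -/
def IsBudRerooting (t u : TreeClass) : Prop :=
  ∃ T : LabelledTree, T.toClass = t ∧
    ((T.IsBalanced ∧ u = t) ∨
      ∃ (b : Fin T.size) (hb : T.map.IsHalfEdge b),
        T.map.Matched b T.root ∧ u = (T.reroot b hb).toClass)

/-! ### Re-rooting as a bijective relation -/

namespace IsBudRerooting

open LabelledTree

variable {t t' u u' : TreeClass} {m : ℕ}

/-- The relation only provides some representative of `t`; an isomorphism carries the matched bud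
over to any other. -/
theorem exists_matched (h : IsBudRerooting t u) {T : LabelledTree} (hT : T.toClass = t) :
    (T.IsBalanced ∧ u = t) ∨ (¬ T.IsBalanced ∧ ∃ (b : Fin T.size) (hb : T.map.IsHalfEdge b),
      T.map.Matched b T.root ∧ u = (T.reroot b hb).toClass) := by
  obtain ⟨T', hT', ⟨hbal, hu⟩ | ⟨b, hb, hm, hu⟩⟩ := h
  · exact Or.inl ⟨(isBalanced_iff (hT'.trans hT.symm)).1 hbal, hu⟩
  · obtain ⟨e, he, hr⟩ := toClass_eq_iff.1 (hT'.trans hT.symm)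
    have hme : T.map.Matched (e b) T.root := by rw [← hr, he.matched_iff]; exact hm
    refine Or.inr ⟨fun h => h.2 _ hme, e b, (he.isHalfEdge_iff b).2 hb, hme, ?_⟩
    rw [hu]
    exact toClass_eq_iff.2 ⟨e, he, rfl⟩

theorem counts_eq (h : IsBudRerooting t u) {T U : LabelledTree} (hT : T.toClass = t)
    (hU : U.toClass = u) (k : ℕ) :
    U.map.whiteCount k = T.map.whiteCount k ∧ U.map.blackCount k = T.map.blackCount k := by
  rcases h.exists_matched hT with ⟨-, hu⟩ | ⟨-, b, hb, -, hu⟩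
  · exact LabelledTree.counts_eq (hT.trans (hu.symm.trans hU.symm)) k
  · exact LabelledTree.counts_eq (T := T.reroot b hb) (hu.symm.trans hU.symm) k

theorem left_unique (h : IsBudRerooting t u) (h' : IsBudRerooting t' u) : t = t' := by
  obtain ⟨T, hT, h⟩ := h
  obtain ⟨T', hT', h'⟩ := h'
  -- The colour at the root tells the two cases apart: a balanced tree has a leaf as root, a
  -- re-rooted one a bud.
  have key : ∀ {T T' : LabelledTree} {b : Fin T'.size} {hb : T'.map.IsHalfEdge b},
      T.IsBalanced → T'.map.Matched b T'.root → T.toClass ≠ (T'.reroot b hb).toClass := by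
    intro T T' b hb hbal hm he
    have h1 : T'.map.IsLeaf b := (isLeaf_root_iff he).1 hbal.1
    exact absurd (h1.2.symm.trans hm.isBud.2) (by simp)
  rcases h with ⟨hbal, hu⟩ | ⟨b, hb, hm, hu⟩ <;> rcases h' with ⟨hbal', hu'⟩ | ⟨b', hb', hm', hu'⟩
  · exact hu.symm.trans hu'
  · exact absurd (hT.trans (hu.symm.trans hu')) (key hbal hm')
  · exact absurd (hT'.trans (hu'.symm.trans hu)) (key hbal' hm)
  · obtain ⟨e, he, hr⟩ := toClass_eq_iff.1 (hu.symm.trans hu')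
    have hr' : e b = b' := hr
    have he' : T.map.Isom T'.map e := he
    rw [← hT, ← hT']
    refine toClass_eq_iff.2 ⟨e, he', ?_⟩
    -- An isomorphism that respects the buds also respects their matched leaves, the original roots.
    exact (((he'.matched_iff _ _).2 hm).unique hm').1 hr'

theorem exists_right (hm : 1 ≤ m) (ht : t ∈ WHat m ((m : ℤ) - 1)) :
    ∃ u ∈ WHatStar m ((m : ℤ) - 1) ∪ BHat m ((m : ℤ) + 1), IsBudRerooting t u := by
  obtain ⟨T, rfl, hbl, hleaf, hch, hdeg⟩ := ht
  by_cases hbal : T.IsBalanced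
  · exact ⟨_, Or.inl ⟨T, rfl, hbl, hleaf, hch, hdeg, hbal⟩, T, rfl, Or.inl ⟨hbal, rfl⟩⟩
  obtain ⟨b, hb⟩ := exists_matched_root hleaf hbal
  have htot : T.map.totalCharge = m := by
    have := charge_of_isLeaf hleaf
    omega
  refine ⟨(T.reroot b hb.isBud.1).toClass, Or.inr ⟨T.reroot b hb.isBud.1, rfl,
    hbl.reroot hm hdeg htot _ _, hb.isBud, ?_, hdeg⟩, T, rfl, Or.inr ⟨b, _, hb, rfl⟩⟩
  rw [charge_of_isBud (T := T.reroot b hb.isBud.1) hb.isBud]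
  exact congrArg (· + 1) htot

theorem right_unique (h : IsBudRerooting t u) (h' : IsBudRerooting t u') : u = u' := by
  obtain ⟨T, hT, -⟩ := id h
  rcases h.exists_matched hT with ⟨hb, hu⟩ | ⟨hb, b, hbh, hm, hu⟩ <;>
    rcases h'.exists_matched hT with ⟨hb', hu'⟩ | ⟨hb', b', hbh', hm', hu'⟩
  · exact hu.trans hu'.symm
  · exact absurd hb hb'
  · exact absurd hb' hb
  · obtain rfl := (hm.unique hm').2 rfl
    exact hu.trans hu'.symm

theorem exists_left (hm : 1 ≤ m)
    (hu : u ∈ WHatStar m ((m : ℤ) - 1) ∪ BHat m ((m : ℤ) + 1)) :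
    ∃ t ∈ WHat m ((m : ℤ) - 1), IsBudRerooting t u := by
  rcases hu with ⟨T, rfl, hbl, hleaf, hch, hdeg, hbal⟩ | ⟨U, rfl, hbl, hbud, hch, hdeg⟩
  · exact ⟨_, ⟨T, rfl, hbl, hleaf, hch, hdeg⟩, T, rfl, Or.inl ⟨hbal, rfl⟩⟩
  have htot : U.map.totalCharge = m := by
    have := charge_of_isBud hbud
    omega
  -- The total charge `m` is positive, so the root bud has a partner: the inverse re-roots there.
  obtain ⟨l, hl⟩ := U.isTree.exists_matched U.map (by omega) hbud
  refine ⟨(U.reroot l hl.isLeaf.1).toClass, ⟨U.reroot l hl.isLeaf.1, rfl,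
    hbl.reroot hm hdeg htot _ _, hl.isLeaf, ?_, hdeg⟩, U.reroot l hl.isLeaf.1, rfl,
    Or.inr ⟨U.root, U.isHalfEdge_root, hl, rfl⟩⟩
  rw [charge_of_isLeaf (T := U.reroot l hl.isLeaf.1) hl.isLeaf]
  exact congrArg (· - 1) htot

end IsBudRerooting

theorem mainTheorem5 (m : ℕ) (hm : 1 ≤ m) :
    -- a degree-preserving bijection
    (∃ f : ↥(WHat m ((m : ℤ) - 1)) ≃ ↥(WHatStar m ((m : ℤ) - 1) ∪ BHat m ((m : ℤ) + 1)),
      (∀ (t : ↥(WHat m ((m : ℤ) - 1))) (T U : LabelledTree),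
        T.toClass = (t : TreeClass) → U.toClass = (f t : TreeClass) →
          ∀ k : ℕ, U.map.whiteCount k = T.map.whiteCount k ∧
            U.map.blackCount k = T.map.blackCount k) ∧
      -- it fixes the balanced trees, and re-roots the others at the bud matched with the root
      (∀ (t : ↥(WHat m ((m : ℤ) - 1))) (T : LabelledTree), T.toClass = (t : TreeClass) →
        (T.IsBalanced → (f t : TreeClass) = T.toClass) ∧
        (¬ T.IsBalanced → ∃ (b : Fin T.size) (hb : T.map.IsHalfEdge b),
          T.map.Matched b T.root ∧ (f t : TreeClass) = (T.reroot b hb).toClass))) ∧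
    -- blossom trees of total charge `m` with these degrees have no weak edge
    (∀ T : LabelledTree, T.IsBlossom → T.map.totalCharge = (m : ℤ) → T.DegreesMultipleOf m →
      ¬ T.HasWeakEdge) := by
  refine ⟨?_, fun T hT ht hd => hT.not_hasWeakEdge hm hd ht⟩
  choose f hf hfr using fun t : ↥(WHat m ((m : ℤ) - 1)) => IsBudRerooting.exists_right hm t.2
  have hbij : Function.Bijective fun t => (⟨f t, hf t⟩ :
      ↥(WHatStar m ((m : ℤ) - 1) ∪ BHat m ((m : ℤ) + 1))) := by
    constructor
    · intro t t' h
      have h' : f t = f t' := congrArg Subtype.val h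
      exact Subtype.ext ((hfr t).left_unique (h' ▸ hfr t'))
    · rintro ⟨u, hu⟩
      obtain ⟨t, ht, htu⟩ := IsBudRerooting.exists_left hm hu
      exact ⟨⟨t, ht⟩, Subtype.ext ((hfr ⟨t, ht⟩).right_unique htu)⟩
  refine ⟨Equiv.ofBijective _ hbij, fun t T U hT hU => (hfr t).counts_eq hT hU,
    fun t T hT => ?_⟩
  rcases (hfr t).exists_matched hT with ⟨hb, hu⟩ | ⟨hb, h⟩
  · exact ⟨fun _ => hu.trans hT.symm, fun h => absurd hb h⟩
  · exact ⟨fun h' => absurd h' hb, fun _ => h⟩
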